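/- **Setting.** A finite 2-complex with cyclic structure consists of finite sets $V$ (vertices), $E$ (edges), $F$ (faces), maps $\partial_+,\partial_-\colon E\to V$ (end point and starting point), and for each face $f$ a number $N(f)\ge 1$, boundary edges $\partial_1f,\dots,\partial_{N(f)}f\in E$ and signs $\epsilon_1f,\dots,\epsilon_{N(f)}f\in\{+1,-1\}$ such that, with indices $k$ read cyclically modulo $N(f)$, $$\partial_{-\epsilon_kf}\,\partial_kf=\partial_{\epsilon_{k+1}f}\,\partial_{k+1}f\qquad(1\le k\le N(f)).$$ The *corners* of $f$ are its boundary vertices counted as often as the boundary path visits them: the corner $c\in\{1,\dots,N(f)\}$ is the vertex $\partial_{\epsilon_cf}\partial_cf=\partial_{-\epsilon_{c-1}f}\partial_{c-1}f$. Let $e_\pm$ be the set of occurrences $(f,k)$ with $\partial_kf=e$ and $\epsilon_kf=\pm1$, let $\delta e\subseteq F$ be the set of faces that contain $e$ in their boundary, and $\partial f\subseteq E$ the set of boundary edges of $f$. For an occurrence $(f,k)$ of $e$ and a sign $\sigma$, the corner of $f$ at $\partial_\sigma e$ is $k$ if $\sigma=\epsilon_kf$ and $k+1$ otherwise. For $j\in\frac12\mathbb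 N_0$ let $t^{(j)}_{mn}$, $1\le m,n\le 2j+1$, be the matrix elements in an orthonormal basis of the unitary irreducible representation of $SU(2)\cong S^3$ of dimension $2j+1$, and $\chi^{(j)}=\sum_n t^{(j)}_{nn}$ its character; $dg$ is the Haar measure of total mass $1$. The Barrett–Crane intertwiner $\bigotimes_r V_{(j_r,j_r^*)}\to\bigotimes_s V_{(k_s,k_s^*)}$ has the matrix elements $$I_{(m_1n_1)\dots;(p_1q_1)\dots}=\int_{SU(2)}\overline{\prod_r t^{(j_r)}_{p_rq_r}(x)}\,\prod_s t^{(k_s)}_{m_sn_s}(x)\,dx .$$ Given a face amplitude $\hat w_j\in\mathbb C$ and edge amplitudes $\hat A^{(e)}\big((j_f)_{f\in\delta e}\big)\in\mathbb C$, the partition function of the (generalized) Barrett–Crane model is $$Z=\sum_{(j_f)\in(\frac12\mathbb N_0)^F}\Big(\prod_{f}\hat w_{j_f}\Big)\Big(\prod_{e}\hat A^{(e)}\big((j_f)_{f\in\delta e}\big)\Big)\sum_{n,m}\ \prod_{e}I^{(+,e)}\,I^{(-,e)},$$ where the inner sum runs over one pair $(n(f,c),m(f,c))\in\{1,\dots,2j_f+1\}^2$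 for each face $f$ and each corner $c$ of $f$. Here $I^{(+,e)}$ is the matrix element of the intertwiner from the occurrences in $e_-$ to those in $e_+$, taken at the index pairs of the corners at $\partial_+e$, and $I^{(-,e)}$ that of the intertwiner from $e_+$ to $e_-$, taken at the index pairs of the corners at $\partial_-e$. **Theorem (dual variables).** For variables $(g_e^{(+)},g_e^{(-)})\in SU(2)\times SU(2)$, $e\in E$, put for each face $f$ and $1\le k\le N(f)$ $$g_{f,k}^{(+)}:=g_{\partial_kf}^{(\epsilon_kf)},\qquad g_{f,k}^{(-)}:=g_{\partial_kf}^{(-\epsilon_kf)},$$ so that $g_{f,k}^{(\pm)}=g_{\partial_kf}^{(\pm)}$ if $\epsilon_kf=+1$, and the two are exchanged if $\epsilon_kf=-1$. Suppose that the series over $(j_f)\in(\frac12\mathbb N_0)^F$ $$W(g)=\sum_{(j_f)}\Big(\prod_{e}\hat A^{(e)}\big((j_f)_{f\in\delta e}\big)\Big)\prod_{f}\Big[\hat w_{j_f}\prod_{c=1}^{N(f)}\chi^{(j_f)}\big(g_{f,c}^{(+)}\,(g_{f,c-1}^{(-)})^{-1}\big)\Big]$$ converges unconditionally in $L^1(SU(2)^E\times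 SU(2)^E)$ to $W$ (for instance unconditionally in $L^2$, or with a convergent sum of $L^1$-norms). Then the series $Z$ converges absolutely, and $$Z=\Big(\prod_{e\in E}\int_{SU(2)}dg_e^{(+)}\int_{SU(2)}dg_e^{(-)}\Big)\,W(g).$$ If moreover the edge amplitude factorizes, $\hat A^{(e)}\big((j_f)_{f\in\delta e}\big)=\prod_{f\in\delta e}\hat v_{j_f}$ with $\hat v_j\in\mathbb C$, and for each face $f$ the series $$\varphi_f\big(g_1^{(+)},g_1^{(-)},\dots,g_N^{(+)},g_N^{(-)}\big)=\sum_{j\in\frac12\mathbb N_0}\hat w_j\,\hat v_j^{|\partial f|}\,\chi^{(j)}\big(g_2^{(+)}(g_1^{(-)})^{-1}\big)\,\chi^{(j)}\big(g_3^{(+)}(g_2^{(-)})^{-1}\big)\cdots\chi^{(j)}\big(g_1^{(+)}(g_N^{(-)})^{-1}\big),\quad N=N(f),$$ evaluated at $g_k^{(\pm)}=g_{f,k}^{(\pm)}$, converges unconditionally to $\varphi_f$ at least in measure on $SU(2)^E\times SU(2)^E$, then the Boltzmann weight is local: $\prod_f\varphi_f$ is integrable and $$Z=\Big(\prod_{e\in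 E}\int_{SU(2)}dg_e^{(+)}\int_{SU(2)}dg_e^{(-)}\Big)\,\prod_{f\in F}\varphi_f\big(g_{f,1}^{(+)},g_{f,1}^{(-)},\dots,g_{f,N(f)}^{(+)},g_{f,N(f)}^{(-)}\big).$$ -/

import Mathlib

open MeasureTheory Filter Topology

noncomputable section

namespace BarrettCrane

/-! ### The group `SU(2) ≅ S³`, its Haar measure and its irreducible representations -/

/-- The compact group `SU(2)`, which is also the model of the sphere `S³`. -/
abbrev SU2 : Type := Matrix.specialUnitaryGroup (Fin 2) ℂ

instance : MeasurableSpace SU2 := borel SU2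

instance : BorelSpace SU2 := ⟨rfl⟩

instance : IsTopologicalGroup SU2 where
  continuous_mul := continuous_mul
  continuous_inv := by
    refine Continuous.subtype_mk (f := fun x : SU2 => star x.1) ?_ _
    exact continuous_star.comp continuous_subtype_val

instance : CompactSpace SU2 := by
  refine isCompact_iff_compactSpace.mp ?_
  have hc : IsClosed ((Matrix.specialUnitaryGroup (Fin 2) ℂ : Submonoid _) :
      Set (Matrix (Fin 2) (Fin 2) ℂ)) := by
    have : ((Matrix.specialUnitaryGroup (Fin 2) ℂ : Submonoid _) :
        Set (Matrix (Fin 2) (Fin 2) ℂ)) = {A | A * star A = 1} ∩ {A | A.det = 1} := by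
      ext A
      simp [Matrix.mem_specialUnitaryGroup_iff, Matrix.mem_unitaryGroup_iff]
    rw [this]
    refine IsClosed.inter ?_ ?_
    · exact isClosed_eq (continuous_id.mul continuous_star) continuous_const
    · exact isClosed_eq (Continuous.matrix_det continuous_id) continuous_const
  have hb : IsCompact (Set.univ.pi fun _ : Fin 2 => Set.univ.pi fun _ : Fin 2 =>
      Metric.closedBall (0 : ℂ) 1) :=
    isCompact_univ_pi fun _ => isCompact_univ_pi fun _ => isCompact_closedBall _ _
  refine hb.of_isClosed_subset hc ?_
  intro A hA i _ j _
  rw [mem_closedBall_zero_iff]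
  exact entry_norm_bound_of_unitary (Matrix.specialUnitaryGroup_le_unitaryGroup hA) i j

/-- The Haar measure of `SU(2)`, normalized to total mass `1`. -/
def haarSU2 : Measure SU2 := Measure.haarMeasure ⊤

/-- A spin `j ∈ {0, 1/2, 1, …}` is encoded by the natural number `2 j`;
the representation `V_j` has dimension `2 j + 1`. -/
abbrev Spin : Type := ℕ

/-- The representation functions `t^{(j)}_{mk}` with `n = 2 j`: the unitary irreducible
representation of `SU(2)` on homogeneous polynomials of degree `n` in two variables `x, y`,
where `g` substitutes `x ↦ g₀₀ x + g₁₀ y` and `y ↦ g₀₁ x + g₁₁ y`, written in the orthonormal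
basis `√(n choose k) x^(n-k) y^k`, `0 ≤ k ≤ n`.  The coefficient of `x^(n-m) y^m` in the image of
`x^(n-k) y^k` is read off after setting `x = 1`, `y = X`. -/
def repMatrix (n : Spin) (g : SU2) : Matrix (Fin (n + 1)) (Fin (n + 1)) ℂ := fun m k =>
  (Real.sqrt ((n.choose k : ℝ) / (n.choose m : ℝ)) : ℂ) *
    ((Polynomial.C (g.1 0 0) + Polynomial.C (g.1 1 0) * Polynomial.X) ^ (n - (k : ℕ)) *
      (Polynomial.C (g.1 0 1) + Polynomial.C (g.1 1 1) * Polynomial.X) ^ (k : ℕ)).coeff m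

/-- The character `χ^{(j)}` of `SU(2)`. -/
def character (n : Spin) (g : SU2) : ℂ := (repMatrix n g).trace

/-- The matrix elements `I_{(m n)…;(p q)…}` of the Barrett–Crane intertwiner
`⨂_{r ∈ R} V_{(j_r, j_r*)} → ⨂_{s ∈ S} V_{(k_s, k_s*)}`: the integral over `S³` of the spherical
functions with the index pairs `a` of the codomain times the complex conjugates of those with the
index pairs `b` of the domain. -/
def bcIntertwiner {R S : Type*} [Fintype R] [Fintype S] (j : R → Spin) (k : S → Spin)
    (a : (s : S) → Fin (k s + 1) × Fin (k s + 1))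
    (b : (r : R) → Fin (j r + 1) × Fin (j r + 1)) : ℂ :=
  ∫ x, (starRingEnd ℂ) (∏ r, repMatrix (j r) x (b r).1 (b r).2) *
    ∏ s, repMatrix (k s) x (a s).1 (a s).2 ∂haarSU2

/-! ### Two-complexes with cyclic structure -/

/-- A 2-complex with cyclic structure.  Signs are elements of `ℤˣ = {1, -1}`; `bd 1 = ∂₊` is the
end point and `bd (-1) = ∂₋` the starting point of an edge.  The boundary edges of a face are
numbered by `Fin (N f)`, and `finRotate` is the cyclic successor. -/
structure CyclicComplex (V E F : Type*) where
  bd : ℤˣ → E → V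
  N : F → ℕ
  N_pos : ∀ f, 0 < N f
  edge : (f : F) → Fin (N f) → E
  sgn : (f : F) → Fin (N f) → ℤˣ
  closed : ∀ (f : F) (k : Fin (N f)),
    bd (-sgn f k) (edge f k) =
      bd (sgn f (finRotate (N f) k)) (edge f (finRotate (N f) k))

namespace CyclicComplex

variable {V E F : Type*} (X : CyclicComplex V E F)

/-- The boundary vertices `f₀` of a face, counted as often as the boundary path visits them, are
the corners `c : Fin (N f)`; the corner `c` is the vertex which the `c`-th boundary edge, followed
in the direction given by its sign, runs into. -/
def cornerVertex (f : F) (c : Fin (X.N f)) : V := X.bd (X.sgn f c) (X.edge f c)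

/-- The corner of `f` at the end `∂_σ e` of the `k`-th boundary edge `e` of `f`. -/
def cornerAt (f : F) (k : Fin (X.N f)) (σ : ℤˣ) : Fin (X.N f) :=
  if σ = X.sgn f k then k else finRotate (X.N f) k

theorem cornerVertex_cornerAt (f : F) (k : Fin (X.N f)) (σ : ℤˣ) :
    X.cornerVertex f (X.cornerAt f k σ) = X.bd σ (X.edge f k) := by
  unfold cornerVertex cornerAt
  split_ifs with h
  · rw [h]
  · rw [← X.closed f k]
    congr 1
    rcases Int.units_eq_one_or σ with h1 | h1 <;>
      rcases Int.units_eq_one_or (X.sgn f k) with h2 | h2 <;> simp_all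

/-- `e₊` (for `σ = 1`) and `e₋` (for `σ = -1`) with multiplicity: the occurrences `(f, k)` of the
edge `e` with sign `σ` in the boundaries of the faces. -/
abbrev Occ (e : E) (σ : ℤˣ) : Type _ :=
  {p : (f : F) × Fin (X.N f) // X.edge p.1 p.2 = e ∧ X.sgn p.1 p.2 = σ}

instance [Fintype F] (e : E) (σ : ℤˣ) : Fintype (X.Occ e σ) := Fintype.ofFinite _

open Classical in
/-- `δe`: the set of all faces that have the edge `e` in their boundary. -/
def cobd [Fintype F] (e : E) : Finset F :=
  Finset.univ.filter fun f => ∃ k, X.edge f k = e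

open Classical in
/-- `∂f`: the set of all edges in the boundary of the face `f`. -/
def bdEdges (f : F) : Finset E := Finset.univ.image (X.edge f)

/-! ### The Barrett–Crane model -/

variable [Fintype E] [Fintype F]

/-- The values of the indices `(n(f,v), m(f,v))`, one pair for each face and each of its corners. -/
abbrev Indices (j : F → Spin) : Type _ :=
  (f : F) → Fin (X.N f) → Fin (j f + 1) × Fin (j f + 1)

/-- The index pairs at the end `∂_σ e` of the edge `e`, for the faces in `e_τ`. -/
def indicesAt {j : F → Spin} (i : X.Indices j) (e : E) (σ τ : ℤˣ) (p : X.Occ e τ) :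
    Fin (j p.1.1 + 1) × Fin (j p.1.1 + 1) :=
  i p.1.1 (X.cornerAt p.1.1 p.1.2 σ)

/-- The intertwiner coefficient `I^{(+,e)}`, from the faces in `e₋` to those in `e₊`. -/
def interPlus {j : F → Spin} (i : X.Indices j) (e : E) : ℂ :=
  bcIntertwiner (fun p : X.Occ e (-1) => j p.1.1) (fun p : X.Occ e 1 => j p.1.1)
    (X.indicesAt i e 1 1) (X.indicesAt i e 1 (-1))

/-- The intertwiner coefficient `I^{(-,e)}`, from the faces in `e₊` to those in `e₋`. -/
def interMinus {j : F → Spin} (i : X.Indices j) (e : E) : ℂ :=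
  bcIntertwiner (fun p : X.Occ e 1 => j p.1.1) (fun p : X.Occ e (-1) => j p.1.1)
    (X.indicesAt i e (-1) (-1)) (X.indicesAt i e (-1) 1)

/-- An edge amplitude: for each edge `e` a function of the spins of the faces in `δe`. -/
abbrev EdgeAmplitude : Type _ := (e : E) → ({f : F // f ∈ X.cobd e} → Spin) → ℂ

open Classical in
/-- The contribution of the face colouring `j` to the partition function. -/
def bcTerm (w : Spin → ℂ) (A : X.EdgeAmplitude) (j : F → Spin) : ℂ :=
  (∏ f, w (j f)) * (∏ e, A e fun f => j f) *
    ∑ i : X.Indices j, ∏ e, X.interPlus i e * X.interMinus i e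

/-- The partition function of the Barrett–Crane model with face amplitude `w` and edge
amplitude `A`. -/
def partitionFunction (w : Spin → ℂ) (A : X.EdgeAmplitude) : ℂ :=
  ∑' j : F → Spin, X.bcTerm w A j

/-! ### The dual variables -/

/-- A pair `(g_e^{(+)}, g_e^{(-)})` for each edge. -/
abbrev Config (E : Type*) : Type _ := E → SU2 × SU2

/-- The product of the normalized Haar measures over all `g_e^{(+)}` and `g_e^{(-)}`. -/
def configMeasure (E : Type*) [Fintype E] : Measure (Config E) :=
  Measure.pi fun _ => haarSU2.prod haarSU2

/-- `g_e^{(σ)}` for a sign `σ`. -/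
def component (p : SU2 × SU2) (σ : ℤˣ) : SU2 := if σ = 1 then p.1 else p.2

/-- The variable `g^{(+)}_{v₊(f)}` at the corner `v = c` of the face `f`: it belongs to the boundary
edge that runs into the corner when the edge is followed in the direction given by its sign.  This
is `g_e^{(+)}` if the sign of `e` in `f` is `+1` (so that `v = ∂₊e`), and `g_e^{(-)}` otherwise. -/
def plusVar (g : Config E) (f : F) (c : Fin (X.N f)) : SU2 :=
  component (g (X.edge f c)) (X.sgn f c)

/-- The variable `g^{(-)}_{v₋(f)}` at the corner `v = c` of the face `f`: it belongs to the boundary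
edge that leaves the corner when the edge is followed in the direction given by its sign.  This
is `g_e^{(-)}` if the sign of `e` in `f` is `+1` (so that `v = ∂₋e`), and `g_e^{(+)}` otherwise. -/
def minusVar (g : Config E) (f : F) (c : Fin (X.N f)) : SU2 :=
  component (g (X.edge f ((finRotate (X.N f)).symm c))) (-X.sgn f ((finRotate (X.N f)).symm c))

/-- The contribution of the face colouring `j` to the integrand of the dual partition function. -/
def dualTerm (w : Spin → ℂ) (A : X.EdgeAmplitude) (j : F → Spin) (g : Config E) : ℂ :=
  (∏ e, A e fun f => j f) *
    ∏ f, (w (j f) * ∏ c, character (j f) (X.plusVar g f c * (X.minusVar g f c)⁻¹))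

/-- The arguments `(g_1^{(+)}, g_1^{(-)}, …, g_N^{(+)}, g_N^{(-)})` of the weight of the face `f`:
the pairs at its boundary edges, with the two members exchanged where the sign is `-1`. -/
def faceArgs (g : Config E) (f : F) (k : Fin (X.N f)) : SU2 × SU2 :=
  (component (g (X.edge f k)) (X.sgn f k), component (g (X.edge f k)) (-X.sgn f k))

/-- The contribution of the spin `j` to the local weight of the face `f`,
`w_j v_j^{|∂f|} χ^{(j)}(g_2^{(+)} (g_1^{(-)})⁻¹) ⋯ χ^{(j)}(g_1^{(+)} (g_N^{(-)})⁻¹)`. -/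
def weightTerm (w v : Spin → ℂ) (f : F) (j : Spin) (h : Fin (X.N f) → SU2 × SU2) : ℂ :=
  w j * v j ^ (X.bdEdges f).card *
    ∏ k, character j ((h (finRotate (X.N f) k)).1 * (h k).2⁻¹)

end CyclicComplex

/-! ### Sums of series of functions -/

/-- `S` is integrable and is the sum of the series `∑ i, u i` in the sense of unconditional
convergence in `L¹(μ)`. -/
def IsSumInL1 {α ι : Type*} [MeasurableSpace α] (μ : Measure α) (u : ι → α → ℂ) (S : α → ℂ) :
    Prop :=
  Integrable S μ ∧
    Tendsto (fun s : Finset ι => ∫⁻ x, ‖(∑ i ∈ s, u i x) - S x‖ₑ ∂μ) atTop (𝓝 0)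

/-- `S` is the sum of the series `∑ i, u i` in the sense of unconditional convergence
in measure. -/
def IsSumInMeasure {α ι : Type*} [MeasurableSpace α] (μ : Measure α) (u : ι → α → ℂ)
    (S : α → ℂ) : Prop :=
  TendstoInMeasure μ (fun (s : Finset ι) x => ∑ i ∈ s, u i x) atTop S

end BarrettCrane

end

noncomputable section

namespace BarrettCrane

/-! The representation is multiplicative and unitary, so a character at `g * h⁻¹` is the Hermitian
pairing of the matrix elements at `g` and at `h` (`character_mul_inv`). Expanding all characters of
a colouring gives one index pair per corner, and each occurrence of an edge contributes a plain
matrix element at one of its two variables and a conjugated one at the other. Sorted by edges, the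
integrand is a product of functions of single variables, and Fubini turns it into the product of
intertwiners (`integral_prod_occFactor`). Thus the two series agree term by term
(`integral_dualTerm`); `L¹` convergence moves the integral through the sum, and unconditional
summability in `ℂ` is absolute.

For the local form, the dual term is a product over faces, so its partial sum over a cube of
colourings is a product of one-spin partial sums. Along a common subsequence both sides converge
almost everywhere, which identifies `W` with the product of the face weights
(`IsSumInL1.ae_eq_prod`). -/

open Polynomial in
/-- The image of `x^(n-k) y^k` under the substitution `x ↦ M₀₀ x + M₁₀ y`, `y ↦ M₀₁ x + M₁₁ y`,
dehomogenized by `x = 1`, `y = X`. -/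
def substPoly {R : Type*} [CommRing R] (n : ℕ) (M : Matrix (Fin 2) (Fin 2) R) (k : ℕ) : R[X] :=
  (C (M 0 0) + C (M 1 0) * X) ^ (n - k) * (C (M 0 1) + C (M 1 1) * X) ^ k

/-! ### Binary forms under linear substitution -/

section SubstPoly

open Polynomial

variable {R : Type*} [CommRing R]

theorem natDegree_linear_pow_le (a c : R) (k : ℕ) :
    ((C a + C c * X) ^ k).natDegree ≤ k := by
  refine natDegree_pow_le.trans ?_
  have : (C a + C c * X).natDegree ≤ 1 := by
    rw [add_comm]; exact natDegree_linear_le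
  simpa using Nat.mul_le_mul_left k this

theorem homogenize_linear_pow (a c : R) (k : ℕ) :
    ((C a + C c * X) ^ k).homogenize k =
      (MvPolynomial.C a * MvPolynomial.X 1 + MvPolynomial.C c * MvPolynomial.X 0) ^ k := by
  induction k with
  | zero => simp
  | succ k ih =>
    rw [pow_succ, homogenize_mul _ _ (natDegree_linear_pow_le a c k)
      (by simpa using natDegree_linear_pow_le a c 1), ih, pow_succ]
    simp

theorem homogenize_substPoly {n k : ℕ} (hk : k ≤ n) (M : Matrix (Fin 2) (Fin 2) R) :
    (substPoly n M k).homogenize n =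
      (MvPolynomial.C (M 0 0) * MvPolynomial.X 1 +
          MvPolynomial.C (M 1 0) * MvPolynomial.X 0) ^ (n - k) *
        (MvPolynomial.C (M 0 1) * MvPolynomial.X 1 +
          MvPolynomial.C (M 1 1) * MvPolynomial.X 0) ^ k := by
  have h := homogenize_mul _ _ (natDegree_linear_pow_le (M 0 0) (M 1 0) (n - k))
    (natDegree_linear_pow_le (M 0 1) (M 1 1) k)
  rw [Nat.sub_add_cancel hk, homogenize_linear_pow, homogenize_linear_pow] at h
  exact h

/-- Homogenizing restores the powers of `x` lost by setting `x = 1`, so that linear forms can be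
substituted: `U` for `x` and `V` for `y`. -/
theorem aeval_homogenize (p : R[X]) (n : ℕ) (V U : R[X]) :
    MvPolynomial.aeval ![V, U] (p.homogenize n) =
      ∑ l ∈ Finset.range (n + 1), C (p.coeff l) * (U ^ (n - l) * V ^ l) := by
  rw [homogenize, map_sum, Finset.Nat.sum_antidiagonal_eq_sum_range_succ_mk]
  refine Finset.sum_congr rfl fun l _ => ?_
  rw [Finsupp.update_eq_add_single (by simp), MvPolynomial.monomial_single_add,
    ← MvPolynomial.C_mul_X_pow_eq_monomial]
  simp
  ring

/-- Substituting by `M * M'` means substituting by `M'` and then replacing `x`, `y` by the linear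
forms of `M`; the sum expands the inner form in monomials. For `k > n` the truncated `n - k` would
break homogeneity. -/
theorem substPoly_mul {n k : ℕ} (hk : k ≤ n) (M M' : Matrix (Fin 2) (Fin 2) R) :
    substPoly n (M * M') k =
      ∑ l ∈ Finset.range (n + 1), C ((substPoly n M' k).coeff l) * substPoly n M l := by
  have h := aeval_homogenize (substPoly n M' k) n (C (M 0 1) + C (M 1 1) * X)
    (C (M 0 0) + C (M 1 0) * X)
  rw [homogenize_substPoly hk] at h
  unfold substPoly at h ⊢
  rw [← h]
  simp [Matrix.mul_apply, Fin.sum_univ_two]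
  congr 2 <;> ring

theorem coeff_coeff_swap (p : R[X][X]) (m k : ℕ) :
    ((Bivariate.swap p).coeff m).coeff k = (p.coeff k).coeff m := by
  induction p using Polynomial.induction_on' with
  | add p q hp hq => simp [hp, hq]
  | monomial i q =>
    induction q using Polynomial.induction_on' with
    | add p q hp hq => simp only [map_add, coeff_add, hp, hq]
    | monomial l r =>
      rw [Bivariate.swap_monomial_monomial]
      simp only [coeff_monomial]
      split_ifs <;> simp_all [coeff_monomial]

theorem coeff_add_C_mul_X_pow (a b : R) (n k : ℕ) :
    ((C a + C b * X) ^ n).coeff k = n.choose k * (a ^ (n - k) * b ^ k) := by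
  rw [add_comm, add_pow, finsetSum_coeff]
  have : ∀ i, ((C b * X) ^ i * C a ^ (n - i) * (n.choose i : R[X])).coeff k =
      if k = i then n.choose i * (a ^ (n - i) * b ^ i) else 0 := by
    intro i
    have : (C b * X) ^ i * C a ^ (n - i) * (n.choose i : R[X]) =
        C (n.choose i * (a ^ (n - i) * b ^ i)) * X ^ i := by
      simp [mul_pow]; ring
    rw [this, coeff_C_mul_X_pow]
  simp only [this]
  rw [Finset.sum_ite_eq]
  split_ifs with h
  · rfl
  · rw [Nat.choose_eq_zero_of_lt (by simpa using h)]; simp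

/-- Both sides are coefficients of `(M₀₀ + M₁₀ X + M₀₁ Y + M₁₁ X Y) ^ n`, and exchanging `X` with
`Y` transposes `M`. This symmetry is what makes the binomially weighted basis orthonormal. -/
theorem choose_mul_coeff_substPoly_transpose (n : ℕ) (M : Matrix (Fin 2) (Fin 2) R) (m k : ℕ) :
    (n.choose k : R) * (substPoly n M.transpose k).coeff m =
      n.choose m * (substPoly n M m).coeff k := by
  have key : ∀ (N : Matrix (Fin 2) (Fin 2) R) (m k : ℕ),
      (((C (C (N 0 0) + C (N 1 0) * X) + C (C (N 0 1) + C (N 1 1) * X) * X : R[X][X]) ^ n).coeff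
        k).coeff m = n.choose k * (substPoly n N k).coeff m := by
    intro N m k
    rw [coeff_add_C_mul_X_pow, ← C_eq_natCast, coeff_C_mul, substPoly]
  rw [← key, ← key, ← coeff_coeff_swap, map_pow]
  congr 3
  simp only [map_add, map_mul, Bivariate.swap_X, Bivariate.swap_Y, Bivariate.swap_C_C]
  simp [Matrix.transpose_apply]
  ring

theorem substPoly_map {S : Type*} [CommRing S] (φ : R →+* S) (n : ℕ)
    (M : Matrix (Fin 2) (Fin 2) R) (k : ℕ) :
    substPoly n (M.map φ) k = (substPoly n M k).map φ := by
  simp [substPoly]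

end SubstPoly

/-! ### Multiplicativity, unitarity and continuity of the representation -/

theorem repMatrix_apply (n : Spin) (g : SU2) (m k : Fin (n + 1)) :
    repMatrix n g m k = (Real.sqrt ((n.choose k : ℝ) / (n.choose m : ℝ)) : ℂ) *
      (substPoly n g.1 k).coeff m := rfl

theorem choose_pos_of_fin {n : ℕ} (k : Fin (n + 1)) : (0 : ℝ) < n.choose k := by
  exact_mod_cast Nat.choose_pos (Nat.lt_succ_iff.mp k.2)

theorem repMatrix_mul (n : Spin) (g h : SU2) :
    repMatrix n (g * h) = repMatrix n g * repMatrix n h := by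
  ext m k
  rw [Matrix.mul_apply, repMatrix_apply, Submonoid.coe_mul,
    substPoly_mul (Nat.lt_succ_iff.mp k.2), Polynomial.finsetSum_coeff, Finset.mul_sum,
    Finset.sum_range]
  refine Finset.sum_congr rfl fun l _ => ?_
  rw [repMatrix_apply, repMatrix_apply, Polynomial.coeff_C_mul]
  -- The normalizing factors form a cocycle, so they pass through the intermediate index `l`.
  have : Real.sqrt ((n.choose k : ℝ) / n.choose m) =
      Real.sqrt ((n.choose l : ℝ) / n.choose m) * Real.sqrt ((n.choose k : ℝ) / n.choose l) := by
    have := choose_pos_of_fin l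
    have := choose_pos_of_fin m
    rw [← Real.sqrt_mul (by positivity)]
    congr 1
    field_simp
  rw [this]
  push_cast
  ring

/-- In `SU2` the inverse is the conjugate transpose: conjugation acts on coefficients as a ring
homomorphism, and the transpose is handled by the binomial symmetry. -/
theorem repMatrix_inv (n : Spin) (g : SU2) :
    repMatrix n g⁻¹ = (repMatrix n g).conjTranspose := by
  ext m k
  have hg : (g⁻¹).1 = (g.1.transpose).map (starRingEnd ℂ) := rfl
  rw [Matrix.conjTranspose_apply, repMatrix_apply, repMatrix_apply, hg, substPoly_map,
    Polynomial.coeff_map, ← starRingEnd_apply, map_mul, Complex.conj_ofReal]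
  have h := congrArg (starRingEnd ℂ) (choose_mul_coeff_substPoly_transpose n g.1 m k)
  simp only [map_mul, map_natCast] at h
  have hk := choose_pos_of_fin k
  have hm := choose_pos_of_fin m
  have hs : Real.sqrt ((n.choose m : ℝ) / n.choose k) =
      Real.sqrt ((n.choose k : ℝ) / n.choose m) * ((n.choose m : ℝ) / n.choose k) := by
    rw [Real.sqrt_div hk.le, Real.sqrt_div hm.le]
    have h1 := Real.mul_self_sqrt hk.le
    have h2 := Real.mul_self_sqrt hm.le
    have := Real.sqrt_pos.mpr hk
    have := Real.sqrt_pos.mpr hm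
    rw [← h1, ← h2]
    field_simp
    simp
  rw [hs]
  have hk' : (n.choose k : ℂ) ≠ 0 := by exact_mod_cast hk.ne'
  push_cast
  rw [mul_assoc]
  congr 1
  field_simp
  rw [mul_comm]
  exact h

/-- The character at `g h⁻¹` as a sum over the matrix elements at `g` and at `h`. -/
theorem character_mul_inv (n : Spin) (g h : SU2) :
    character n (g * h⁻¹) = ∑ p : Fin (n + 1) × Fin (n + 1),
      repMatrix n g p.1 p.2 * (starRingEnd ℂ) (repMatrix n h p.1 p.2) := by
  rw [character, repMatrix_mul, repMatrix_inv, Matrix.trace, Fintype.sum_prod_type]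
  simp [Matrix.mul_apply]

theorem continuous_repMatrix_apply (n : Spin) (m k : Fin (n + 1)) :
    Continuous fun g : SU2 => repMatrix n g m k := by
  have hent : ∀ a b, Continuous fun g : SU2 => g.1 a b := fun a b =>
    (continuous_apply_apply a b).comp continuous_subtype_val
  simp only [repMatrix, Polynomial.coeff_mul, coeff_add_C_mul_X_pow]
  refine continuous_const.mul (continuous_finsetSum _ fun x _ => ?_)
  exact (continuous_const.mul (((hent 0 0).pow _).mul ((hent 1 0).pow _))).mul
    (continuous_const.mul (((hent 0 1).pow _).mul ((hent 1 1).pow _)))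

theorem continuous_character (n : Spin) : Continuous (character n) := by
  unfold character Matrix.trace
  exact continuous_finsetSum _ fun i _ => continuous_repMatrix_apply n i i

instance : IsProbabilityMeasure haarSU2 :=
  ⟨by simpa [haarSU2] using
    Measure.haarMeasure_self (K₀ := (⊤ : TopologicalSpace.PositiveCompacts SU2))⟩

/-- Makes the product σ-algebra on configurations the Borel one, so that continuous integrands are
measurable. -/
instance : SecondCountableTopology SU2 :=
  haveI : SecondCountableTopology (Matrix (Fin 2) (Fin 2) ℂ) :=
    inferInstanceAs (SecondCountableTopology (Fin 2 → Fin 2 → ℂ))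
  Topology.IsInducing.subtypeVal.secondCountableTopology

/-! ### Expansion in matrix elements and integration edge by edge -/

namespace CyclicComplex

variable {V E F : Type*} (X : CyclicComplex V E F)

theorem cornerAt_sgn (f : F) (k : Fin (X.N f)) : X.cornerAt f k (X.sgn f k) = k := by
  simp [cornerAt]

theorem cornerAt_neg_sgn (f : F) (k : Fin (X.N f)) :
    X.cornerAt f k (-X.sgn f k) = finRotate (X.N f) k := by
  rcases Int.units_eq_one_or (X.sgn f k) with h | h <;> simp [cornerAt, h]

theorem minusVar_finRotate (g : Config E) (f : F) (k : Fin (X.N f)) :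
    X.minusVar g f (finRotate (X.N f) k) = component (g (X.edge f k)) (-X.sgn f k) := by
  simp only [minusVar, Equiv.symm_apply_apply]

theorem continuous_component (σ : ℤˣ) : Continuous fun p : SU2 × SU2 => component p σ := by
  unfold component
  split_ifs
  exacts [continuous_fst, continuous_snd]

/-- The factor that an occurrence of an edge contributes, at the pair `x` of variables of that
edge, to the expansion of the product of characters in matrix elements. -/
def occFactor {j : F → Spin} (i : X.Indices j) (p : (f : F) × Fin (X.N f)) (x : SU2 × SU2) : ℂ :=
  repMatrix (j p.1) (component x (X.sgn p.1 p.2))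
      (i p.1 (X.cornerAt p.1 p.2 (X.sgn p.1 p.2))).1
      (i p.1 (X.cornerAt p.1 p.2 (X.sgn p.1 p.2))).2 *
    (starRingEnd ℂ) (repMatrix (j p.1) (component x (-X.sgn p.1 p.2))
      (i p.1 (X.cornerAt p.1 p.2 (-X.sgn p.1 p.2))).1
      (i p.1 (X.cornerAt p.1 p.2 (-X.sgn p.1 p.2))).2)

theorem continuous_occFactor {j : F → Spin} (i : X.Indices j) (p : (f : F) × Fin (X.N f)) :
    Continuous (X.occFactor i p) :=
  ((continuous_repMatrix_apply _ _ _).comp (continuous_component _)).mul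
    (Complex.continuous_conj.comp
      ((continuous_repMatrix_apply _ _ _).comp (continuous_component _)))

variable [Fintype F]

open Classical in
theorem prod_character_eq_sum (j : F → Spin) (g : Config E) :
    ∏ f, ∏ c, character (j f) (X.plusVar g f c * (X.minusVar g f c)⁻¹) =
      ∑ i : X.Indices j, ∏ p : (f : F) × Fin (X.N f), X.occFactor i p (g (X.edge p.1 p.2)) := by
  simp only [character_mul_inv, Finset.prod_univ_sum, Fintype.piFinset_univ]
  refine Finset.sum_congr rfl fun i _ => ?_
  rw [Fintype.prod_sigma]
  refine Finset.prod_congr rfl fun f _ => ?_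
  simp only [occFactor, cornerAt_sgn, cornerAt_neg_sgn, Finset.prod_mul_distrib]
  congr 1
  -- The conjugated factor at a corner belongs to the occurrence preceding it, hence the cyclic
  -- shift.
  rw [← Equiv.prod_comp (finRotate (X.N f))]
  simp only [minusVar_finRotate]

variable [Fintype E]

instance : IsProbabilityMeasure (configMeasure E) := by
  unfold configMeasure; infer_instance

theorem integrable_of_continuous {u : Config E → ℂ} (hu : Continuous u) :
    Integrable u (configMeasure E) :=
  hu.integrable_of_hasCompactSupport (HasCompactSupport.of_compactSpace u)

theorem prod_occurrences (G : ((f : F) × Fin (X.N f)) → ℂ) :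
    ∏ p, G p = ∏ e, (∏ p : X.Occ e 1, G p.1) * ∏ p : X.Occ e (-1), G p.1 := by
  classical
  rw [← Finset.prod_fiberwise Finset.univ (fun p => X.edge p.1 p.2)]
  refine Finset.prod_congr rfl fun e _ => ?_
  rw [← Finset.prod_filter_mul_prod_filter_not _ (fun p => X.sgn p.1 p.2 = 1)]
  congr 1
  · exact Finset.prod_subtype _ (by simp) G
  · refine Finset.prod_subtype _ (fun p => ?_) G
    have : X.sgn p.1 p.2 = -1 ↔ ¬ X.sgn p.1 p.2 = 1 := by
      rcases Int.units_eq_one_or (X.sgn p.1 p.2) with h | h <;> simp [h]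
    simp [this]

/-- Fubini applies across edges and then within each pair. At `g_e^{(+)}` the occurrences in `e₊`
are plain and those in `e₋` conjugated, as in `interPlus`; at `g_e^{(-)}` the roles are reversed. -/
theorem integral_prod_occFactor {j : F → Spin} (i : X.Indices j) :
    ∫ g, ∏ p : (f : F) × Fin (X.N f), X.occFactor i p (g (X.edge p.1 p.2)) ∂configMeasure E =
      ∏ e, X.interPlus i e * X.interMinus i e := by
  have h : ∀ g : Config E,
      ∏ p : (f : F) × Fin (X.N f), X.occFactor i p (g (X.edge p.1 p.2)) =
        ∏ e, (∏ p : X.Occ e 1, X.occFactor i p.1 (g e)) *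
          ∏ p : X.Occ e (-1), X.occFactor i p.1 (g e) := by
    intro g
    rw [X.prod_occurrences]
    refine Finset.prod_congr rfl fun e _ => ?_
    exact congrArg₂ (· * ·)
      (Finset.prod_congr rfl fun p _ => congrArg (fun a => X.occFactor i p.1 (g a)) p.2.1)
      (Finset.prod_congr rfl fun p _ => congrArg (fun a => X.occFactor i p.1 (g a)) p.2.1)
  simp only [h, configMeasure]
  rw [integral_fintype_prod_eq_prod (f := fun e x => (∏ p : X.Occ e 1, X.occFactor i p.1 x) *
          ∏ p : X.Occ e (-1), X.occFactor i p.1 x)]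
  refine Finset.prod_congr rfl fun e _ => ?_
  rw [interPlus, interMinus, bcIntertwiner, bcIntertwiner, ← integral_prod_mul]
  refine integral_congr_ae (Eventually.of_forall fun x => ?_)
  have h1 : ∀ p : X.Occ e 1, X.occFactor i p.1 x =
      repMatrix (j p.1.1) x.1 (X.indicesAt i e 1 1 p).1 (X.indicesAt i e 1 1 p).2 *
        (starRingEnd ℂ) (repMatrix (j p.1.1) x.2 (X.indicesAt i e (-1) 1 p).1
          (X.indicesAt i e (-1) 1 p).2) := by
    intro p
    simp [occFactor, indicesAt, p.2.2, component]
  have h2 : ∀ p : X.Occ e (-1), X.occFactor i p.1 x =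
      repMatrix (j p.1.1) x.2 (X.indicesAt i e (-1) (-1) p).1 (X.indicesAt i e (-1) (-1) p).2 *
        (starRingEnd ℂ) (repMatrix (j p.1.1) x.1 (X.indicesAt i e 1 (-1) p).1
          (X.indicesAt i e 1 (-1) p).2) := by
    intro p
    simp [occFactor, indicesAt, p.2.2, component]
  simp only [h1, h2, Finset.prod_mul_distrib, map_prod]
  ring

theorem continuous_dualTerm (w : Spin → ℂ) (A : X.EdgeAmplitude) (j : F → Spin) :
    Continuous (X.dualTerm w A j) := by
  unfold dualTerm
  refine continuous_const.mul (continuous_finsetProd _ fun f _ => continuous_const.mul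
    (continuous_finsetProd _ fun c _ => (continuous_character _).comp (Continuous.mul ?_ ?_)))
  · exact (continuous_component _).comp (continuous_apply _)
  · exact ((continuous_component _).comp (continuous_apply _)).inv

/-- Each term of the partition function is the integral of the corresponding dual term. -/
theorem integral_dualTerm (w : Spin → ℂ) (A : X.EdgeAmplitude) (j : F → Spin) :
    ∫ g, X.dualTerm w A j g ∂configMeasure E = X.bcTerm w A j := by
  simp only [dualTerm, Finset.prod_mul_distrib, prod_character_eq_sum]
  have hintegrable : ∀ i : X.Indices j, Integrable (fun g : Config E =>
      ∏ p : (f : F) × Fin (X.N f), X.occFactor i p (g (X.edge p.1 p.2))) (configMeasure E) :=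
    fun i => integrable_of_continuous (continuous_finsetProd _ fun p _ =>
      (X.continuous_occFactor i p).comp (continuous_apply _))
  rw [integral_const_mul, integral_const_mul, integral_finsetSum _ fun i _ => hintegrable i]
  simp only [integral_prod_occFactor]
  rw [bcTerm]
  ring

/-- The integral is continuous in `L¹`, and convergence along the filter of all finite sets of
colourings is exactly `HasSum`. -/
theorem hasSum_bcTerm {w : Spin → ℂ} {A : X.EdgeAmplitude} {W : Config E → ℂ}
    (hW : IsSumInL1 (configMeasure E) (X.dualTerm w A) W) :
    HasSum (X.bcTerm w A) (∫ g, W g ∂configMeasure E) := by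
  have hintegrable : ∀ j, Integrable (X.dualTerm w A j) (configMeasure E) := fun j =>
    integrable_of_continuous (X.continuous_dualTerm w A j)
  have h := tendsto_integral_of_L1 W hW.1.1
    (Eventually.of_forall fun s : Finset (F → Spin) => integrable_finsetSum s fun j _ => hintegrable j)
    hW.2
  simp only [integral_finsetSum _ fun j _ => hintegrable j, integral_dualTerm] at h
  exact h

/-- Double counting of incident pairs of an edge and a face. Each pair counts once, however often
the boundary path repeats the edge. -/
theorem prod_edge_factorization (v : Spin → ℂ) (j : F → Spin) :
    ∏ e, ∏ f : {f : F // f ∈ X.cobd e}, v (j f) = ∏ f, v (j f) ^ (X.bdEdges f).card := by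
  classical
  have h : ∀ e, ∏ f : {f : F // f ∈ X.cobd e}, v (j f) =
      ∏ f, if e ∈ X.bdEdges f then v (j f) else 1 := by
    intro e
    rw [← Finset.prod_subtype (X.cobd e) (fun _ => Iff.rfl) (fun f => v (j f)),
      ← Finset.prod_filter]
    refine Finset.prod_congr ?_ fun _ _ => rfl
    ext f
    simp [cobd, bdEdges]
  simp only [h]
  rw [Finset.prod_comm]
  refine Finset.prod_congr rfl fun f _ => ?_
  rw [Finset.prod_ite_mem, Finset.univ_inter, Finset.prod_const]

/-- For a factorizing edge amplitude the dual term is a product over the faces. -/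
theorem dualTerm_eq_prod_weightTerm {w v : Spin → ℂ} {A : X.EdgeAmplitude}
    (hA : ∀ (e : E) (j : {f : F // f ∈ X.cobd e} → Spin), A e j = ∏ f, v (j f))
    (j : F → Spin) (g : Config E) :
    X.dualTerm w A j g = ∏ f, X.weightTerm w v f (j f) (X.faceArgs g f) := by
  simp only [dualTerm, hA, prod_edge_factorization, weightTerm]
  rw [← Finset.prod_mul_distrib]
  refine Finset.prod_congr rfl fun f _ => ?_
  rw [← Equiv.prod_comp (finRotate (X.N f))]
  simp only [minusVar_finRotate, plusVar, faceArgs]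
  ring

end CyclicComplex

/-! ### Identifying the limit of a multiple series of products -/

/-- Finitely many sequences that converge in measure have a common subsequence along which all of
them converge almost everywhere. -/
theorem exists_common_seq_tendsto_ae {α ι : Type*} [MeasurableSpace α] {μ : Measure α}
    (s : Finset ι) (u : ι → ℕ → α → ℂ) (S : ι → α → ℂ)
    (h : ∀ i, TendstoInMeasure μ (u i) atTop (S i)) :
    ∃ ns : ℕ → ℕ, Tendsto ns atTop atTop ∧
      ∀ᵐ x ∂μ, ∀ i ∈ s, Tendsto (fun n => u i (ns n) x) atTop (𝓝 (S i x)) := by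
  classical
  induction s using Finset.induction_on with
  | empty => exact ⟨id, tendsto_id, by simp⟩
  | insert i s _ ih =>
    obtain ⟨ns, hns, hae⟩ := ih
    -- Convergence in measure survives along `ns`, so a further subsequence converges almost
    -- everywhere without spoiling the earlier ones.
    obtain ⟨ms, hms, hae'⟩ := ((h i).comp hns).exists_seq_tendsto_ae
    refine ⟨ns ∘ ms, hns.comp hms.tendsto_atTop, ?_⟩
    filter_upwards [hae, hae'] with x hx hx' k hk
    rcases Finset.mem_insert.mp hk with rfl | hk
    · exact hx'
    · exact (hx k hk).comp hms.tendsto_atTop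

theorem tendsto_piFinset_range (F : Type*) [Fintype F] [DecidableEq F] :
    Tendsto (fun n : ℕ => Fintype.piFinset fun _ : F => Finset.range n) atTop atTop := by
  refine tendsto_atTop_finset_of_monotone ?_ ?_
  · intro m n hmn
    exact Fintype.piFinset_subset _ _ fun _ => Finset.range_mono hmn
  · intro j
    -- The sum bounds all spins of `j` at once, so every colouring lies in some cube.
    refine ⟨(∑ f, j f) + 1, Fintype.mem_piFinset.mpr fun f => Finset.mem_range.mpr ?_⟩
    exact Nat.lt_succ_of_le (Finset.single_le_sum (fun _ _ => Nat.zero_le _) (Finset.mem_univ f))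

/-- If a multiple series of products converges unconditionally in `L¹` and the series of the
factors converge unconditionally in measure, then the sum is the product of their sums. -/
theorem IsSumInL1.ae_eq_prod {α F : Type*} [MeasurableSpace α] [Fintype F] {μ : Measure α}
    {u : (F → ℕ) → α → ℂ} {t : F → ℕ → α → ℂ} {S : α → ℂ} {T : F → α → ℂ}
    (hS : IsSumInL1 μ u S) (hu : ∀ j, AEStronglyMeasurable (u j) μ)
    (hprod : ∀ j x, u j x = ∏ f, t f (j f) x)
    (hT : ∀ f, IsSumInMeasure μ (t f) (T f)) :
    S =ᵐ[μ] fun x => ∏ f, T f x := by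
  classical
  obtain ⟨ns, hns, hae⟩ := exists_common_seq_tendsto_ae Finset.univ
    (fun f n x => ∑ j ∈ Finset.range n, t f j x) T
    fun f => (hT f).comp tendsto_finset_range
  have hmeas : TendstoInMeasure μ (fun (s : Finset (F → ℕ)) x => ∑ j ∈ s, u j x) atTop S := by
    refine tendstoInMeasure_of_tendsto_eLpNorm one_ne_zero
      (fun s => Finset.aestronglyMeasurable_fun_sum s fun j _ => hu j) hS.1.1 ?_
    simpa only [eLpNorm_one_eq_lintegral_enorm, Pi.sub_apply] using hS.2
  -- Restricting to cubes is harmless because the convergence to `S` is unconditional; one more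
  -- extraction makes it pointwise almost everywhere.
  obtain ⟨ms, hms, hae'⟩ :=
    ((hmeas.comp (tendsto_piFinset_range F)).comp hns).exists_seq_tendsto_ae
  filter_upwards [hae, hae'] with x hx hx'
  refine tendsto_nhds_unique hx' ?_
  have h := tendsto_finsetProd Finset.univ fun f hf => (hx f hf).comp hms.tendsto_atTop
  refine h.congr fun n => ?_
  -- Distributivity: the sum over a cube is the product of the one-index partial sums.
  simp only [Function.comp_apply, hprod, Finset.prod_univ_sum]

end BarrettCrane

end

open BarrettCrane CyclicComplex in
theorem theorem2 {V E F : Type*} [Finite V] [Fintype E] [Fintype F]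
    (X : CyclicComplex V E F) (w : Spin → ℂ) (A : X.EdgeAmplitude)
    (W : Config E → ℂ) (hW : IsSumInL1 (configMeasure E) (X.dualTerm w A) W) :
    (Summable (X.bcTerm w A) ∧
      X.partitionFunction w A = ∫ g, W g ∂configMeasure E) ∧
    ∀ v : Spin → ℂ,
      (∀ (e : E) (j : {f : F // f ∈ X.cobd e} → Spin), A e j = ∏ f, v (j f)) →
      ∀ φ : (f : F) → (Fin (X.N f) → SU2 × SU2) → ℂ,
        (∀ f, IsSumInMeasure (configMeasure E)
          (fun j g => X.weightTerm w v f j (X.faceArgs g f)) (fun g => φ f (X.faceArgs g f))) →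
        Integrable (fun g => ∏ f, φ f (X.faceArgs g f)) (configMeasure E) ∧
        X.partitionFunction w A = ∫ g, ∏ f, φ f (X.faceArgs g f) ∂configMeasure E := by
  have hsum := X.hasSum_bcTerm hW
  refine ⟨⟨hsum.summable, hsum.tsum_eq⟩, fun v hA φ hφ => ?_⟩
  have hae := hW.ae_eq_prod (t := fun f j g => X.weightTerm w v f j (X.faceArgs g f))
    (fun j => (integrable_of_continuous (X.continuous_dualTerm w A j)).1)
    (X.dualTerm_eq_prod_weightTerm hA) hφ
  exact ⟨hW.1.congr hae, hsum.tsum_eq.trans (integral_congr_ae hae)⟩
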